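/- Let $G$ be a discrete group, let $U:G\to\mathcal B(\ell^2(G))$ be its left regular representation, and let $\mathcal A=C^*\{U_x:x\in G\}\subseteq\mathcal B(\ell^2(G))$ be the reduced group $C^*$-algebra of $G$. Call a linear map $T:\mathcal A\to\mathcal A$ a locally finite contraction if $\|T\|\le 1$ and, for every $a\in\mathcal A$, the norm closure of the orbit $\{a,Ta,T^2a,\dots\}$ is compact. Let $\rho$ be a state of $\mathcal A$. Then there is a unique completely positive linear map $P:\mathcal A\to\mathcal A$ satisfying $$P(U_x)=\rho(U_x)U_x,\qquad x\in G,$$ and $P$ is a locally finite contraction. Let $\mathcal B$ be the $C^*$-subalgebra of $\mathcal A$ generated by $\{U_x:|\rho(U_x)|=1\}$. Then: (i) The restriction $\alpha$ of $P$ to $\mathcal B$ is a $*$-automorphism of $\mathcal B$. (ii) There is a unique completely positive linear map $E:\mathcal A\to\mathcal A$ such that, for every $x\in G$, $E(U_x)=U_x$ if $|\rho(U_x)|=1$ and $E(U_x)=0$ if $|\rho(U_x)|<1$. Moreover $E$ is idempotent, $E\circ E=E$, with range $\mathcal B$. (iii) For every $A\in\mathcal A$, $$\lim_{n\to\infty}\|P^n(A)-\alpha^n(E(A))\|=0.$$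 -/

import Mathlib

open scoped lp ENNReal ComplexOrder CStarAlgebra
open Filter Topology

noncomputable section

namespace ReducedGroup

/-- A linear map `T` on a complex Banach space is a *locally finite contraction* if `‖T x‖ ≤ ‖x‖`
for all `x` (that is, `‖T‖ ≤ 1`) and the orbit `{x, T x, T² x, …}` of every vector `x` has compact
norm closure. -/
def IsLocallyFiniteContraction {X : Type*} [NormedAddCommGroup X] [NormedSpace ℂ X]
    [CompleteSpace X] (T : X →ₗ[ℂ] X) : Prop :=
  (∀ x, ‖T x‖ ≤ ‖x‖) ∧ ∀ x, IsCompact (closure (Set.range fun n : ℕ => (T ^ n) x))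

variable (G : Type*) [Group G]

variable {G} in
lemma memlp_translate (x : G) (f : ℓ²(G, ℂ)) :
    Memℓp (fun y : G => (f : G → ℂ) (x⁻¹ * y)) 2 := by
  have h := (memℓp_gen_iff (by norm_num : 0 < (2 : ℝ≥0∞).toReal)).1 (lp.memℓp f)
  exact memℓp_gen (h.comp_injective (mul_right_injective x⁻¹))

variable {G} in
/-- Left translation by `x` on `ℓ²(G)`, as an isometry: `(U_x f)(y) = f (x⁻¹ y)`. -/
def translate (x : G) : ℓ²(G, ℂ) →ₗᵢ[ℂ] ℓ²(G, ℂ) where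
  toFun f := ⟨fun y => (f : G → ℂ) (x⁻¹ * y), memlp_translate x f⟩
  map_add' _ _ := rfl
  map_smul' _ _ := rfl
  norm_map' f := by
    have h2 : 0 < (2 : ℝ≥0∞).toReal := by norm_num
    rw [lp.norm_eq_tsum_rpow h2, lp.norm_eq_tsum_rpow h2]
    congr 1
    exact (Equiv.mulLeft x⁻¹).tsum_eq fun y => ‖(f : G → ℂ) y‖ ^ (2 : ℝ≥0∞).toReal

/-- The left regular representation of the discrete group `G` on `ℓ²(G)`,
`(U_x f)(y) = f (x⁻¹ y)`. -/
def regularRep : G →* (ℓ²(G, ℂ) →L[ℂ] ℓ²(G, ℂ)) where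
  toFun x := (translate x).toContinuousLinearMap
  map_one' := by
    ext f y
    change (f : G → ℂ) (1⁻¹ * y) = (f : G → ℂ) y
    simp
  map_mul' x z := by
    ext f y
    change (f : G → ℂ) ((x * z)⁻¹ * y) = (f : G → ℂ) (z⁻¹ * (x⁻¹ * y))
    rw [mul_inv_rev, mul_assoc]

/-- The reduced group C⋆-algebra of `G`: the norm-closed unital star subalgebra of the bounded
operators on `ℓ²(G)` generated by the operators of the left regular representation. -/
def reducedCStarAlgebra : StarSubalgebra ℂ (ℓ²(G, ℂ) →L[ℂ] ℓ²(G, ℂ)) :=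
  (StarAlgebra.adjoin ℂ (Set.range (regularRep G))).topologicalClosure

instance isClosed_reducedCStarAlgebra :
    IsClosed (reducedCStarAlgebra G : Set (ℓ²(G, ℂ) →L[ℂ] ℓ²(G, ℂ))) :=
  StarSubalgebra.isClosed_topologicalClosure _

/-- The order inherited from the (Loewner) order of bounded operators on `ℓ²(G)` is the usual
order of the C⋆-algebra: the positive elements are the sums of the elements `s⋆ s`. -/
instance starOrderedRing_reducedCStarAlgebra : StarOrderedRing (reducedCStarAlgebra G) :=
  StarOrderedRing.of_nonneg_iff' (fun {x y} h z => by
      change (z : ℓ²(G, ℂ) →L[ℂ] ℓ²(G, ℂ)) + x ≤ z + y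
      exact add_le_add_right h _) (fun a => by
    constructor
    · intro ha
      have ha' : (0 : ℓ²(G, ℂ) →L[ℂ] ℓ²(G, ℂ)) ≤ a := ha
      have hs : IsSelfAdjoint a := Subtype.ext (IsSelfAdjoint.of_nonneg ha').star_eq
      have hr : SpectrumRestricts a ContinuousMap.realToNNReal := by
        have h := SpectrumRestricts.nnreal_of_nonneg ha'
        rw [SpectrumRestricts.nnreal_iff] at h ⊢
        intro t ht
        refine h t ?_
        rw [← spectrum.algebraMap_mem_iff ℂ] at ht ⊢
        rwa [StarSubalgebra.spectrum_eq (hS := isClosed_reducedCStarAlgebra G)] at ht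
      obtain ⟨s, hs₁, -, hs₂⟩ := CFC.exists_sqrt_of_isSelfAdjoint_of_quasispectrumRestricts hs hr
      exact ⟨s, by rw [hs₁.star_eq, hs₂]⟩
    · rintro ⟨s, rfl⟩
      change (0 : ℓ²(G, ℂ) →L[ℂ] ℓ²(G, ℂ)) ≤ star (s : ℓ²(G, ℂ) →L[ℂ] ℓ²(G, ℂ)) * s
      exact star_mul_self_nonneg _)

variable {G}

/-- The unitary `U_x`, as an element of the reduced group C⋆-algebra. -/
def U (x : G) : reducedCStarAlgebra G :=
  ⟨regularRep G x, StarSubalgebra.le_topologicalClosure _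
    (StarAlgebra.subset_adjoin ℂ _ (Set.mem_range_self x))⟩

/-- The C⋆-subalgebra of the reduced group C⋆-algebra generated by the `U_x` with `|ρ(U_x)| = 1`.
(For a state `ρ` the unit `U_1 = 1` is one of these generators.) -/
def peripheralSubalgebra (ρ : reducedCStarAlgebra G →ₚ[ℂ] ℂ) :
    StarSubalgebra ℂ (reducedCStarAlgebra G) :=
  (StarAlgebra.adjoin ℂ {a | ∃ x : G, ‖ρ (U x)‖ = 1 ∧ U x = a}).topologicalClosure

end ReducedGroup

end

open ReducedGroup

/-! By GNS, `ρ (star a * b)` is a sum of rank one forms, so `ρ (U x) = ∑ᵢ conj (vᵢ y) vᵢ (x⁻¹ y)`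
for every `y`. The map `V f = (vᵢ f)ᵢ` is then an isometry of `ℓ²(G)` into a Hilbert sum of copies
of itself, and compressing the diagonal action of `a` by `V` is completely positive, contractive,
and multiplies `U x` by `ρ (U x)`. This is `P` (`exists_multiplier`). Conjugating the `vᵢ` gives `Q`
with the conjugate symbol; coset indicators of a subgroup give `E`.

Cauchy–Schwarz shows that `ρ` is multiplicative on unitaries where it has modulus one
(`map_mul_of_norm_map_eq_one`). Hence these `x` form a subgroup `N`, `P` is multiplicative on the
closed span of `U x`, `x ∈ N`, and `Q` inverts it there.

The rest is checked on the `U x`, whose span is dense: they are eigenvectors of `P` with eigenvalues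
in the unit disc, so orbits are precompact; off `N` the eigenvalue powers tend to zero, and
contractivity carries this to all of the algebra. -/

open scoped InnerProductSpace InnerProduct

/-! ### Complete positivity of maps with a Stinespring representation -/

section CompletelyPositive

/-- A positive element is of the form `b⋆ b`. -/
theorem NonUnitalCStarAlgebra.exists_eq_star_mul_self {D : Type*} [NonUnitalCStarAlgebra D]
    [PartialOrder D] [StarOrderedRing D] {a : D} (ha : 0 ≤ a) : ∃ b, a = star b * b :=
  CStarAlgebra.nonneg_iff_eq_star_mul_self.1 ha

/-- A selfadjoint element `a` is positive if `c⋆ a c = -(b⋆ b)` holds only with `b = 0`. -/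
theorem NonUnitalCStarAlgebra.nonneg_of_forall_conjugate {D : Type*} [NonUnitalCStarAlgebra D]
    [PartialOrder D] [StarOrderedRing D] {a : D} (ha : IsSelfAdjoint a)
    (h : ∀ b c : D, star c * a * c = -(star b * b) → b = 0) : 0 ≤ a := by
  -- Test with `c = a⁻`: since `a⁻ a⁺ = 0`, the conjugate is `-(a⁻)³`. The hypothesis kills the
  -- cube, and the C⋆-identity applied twice kills `a⁻`.
  have hN : IsSelfAdjoint a⁻ := .of_nonneg (CFC.negPart_nonneg a)
  have hdec : a⁺ - a⁻ = a := CFC.posPart_sub_negPart a ha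
  have hcub : 0 ≤ a⁻ * a⁻ * a⁻ := by
    simpa only [hN.star_eq] using star_left_conjugate_nonneg (CFC.negPart_nonneg a) a⁻
  have hMN : star a⁻ * a * a⁻ = -(a⁻ * a⁻ * a⁻) := by
    conv_lhs => rw [hN.star_eq]; enter [1, 2]; rw [← hdec]
    rw [mul_sub, sub_mul, CFC.negPart_mul_posPart, zero_mul, zero_sub]
  obtain ⟨b, hb⟩ := exists_eq_star_mul_self hcub
  have h3 : a⁻ * a⁻ * a⁻ = 0 := by
    rw [hb, h b a⁻ (by rw [hMN, hb]), mul_zero]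
  have h2 : a⁻ * a⁻ = 0 := by
    rw [← CStarRing.star_mul_self_eq_zero_iff, star_mul, hN.star_eq, ← mul_assoc, h3, zero_mul]
  have h1 : a⁻ = 0 := by
    rw [← CStarRing.star_mul_self_eq_zero_iff, hN.star_eq, h2]
  rw [h1, sub_zero] at hdec
  exact hdec ▸ CFC.posPart_nonneg a

/-- A selfadjoint matrix over a C⋆-algebra is positive as soon as all its values as a quadratic
form are. -/
theorem CStarMatrix.nonneg_of_forall_sum_nonneg {A n : Type*} [NonUnitalCStarAlgebra A]
    [PartialOrder A] [StarOrderedRing A] [Fintype n] {M : CStarMatrix n n A}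
    (hM : IsSelfAdjoint M)
    (h : ∀ v : n → A, 0 ≤ ∑ l, (∑ k, star (v k) * M k l) * v l) : 0 ≤ M := by
  refine NonUnitalCStarAlgebra.nonneg_of_forall_conjugate hM fun S c hS => ?_
  -- The diagonal entry `(c⋆ M c) i i` is the form at column `i` of `c`, hence positive; it is also
  -- minus this sum of squares, so column `i` of `S` vanishes.
  have hdiag (i : n) : ∑ k, star (S k i) * S k i ≤ 0 := by
    have h1 := h fun k => c k i
    have h2 : ∑ l, (∑ k, star (c k i) * M k l) * c l i = (star c * M * c) i i := by
      simp only [CStarMatrix.mul_apply, CStarMatrix.star_apply]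
    rw [h2, hS, CStarMatrix.neg_apply, CStarMatrix.mul_apply, Left.nonneg_neg_iff] at h1
    simpa only [CStarMatrix.star_apply] using h1
  ext k i
  have hz := (Finset.sum_eq_zero_iff_of_nonneg fun k _ => star_mul_self_nonneg (S k i)).1
    (le_antisymm (hdiag i) (Finset.sum_nonneg fun k _ => star_mul_self_nonneg (S k i))) k
    (Finset.mem_univ k)
  exact (CStarRing.star_mul_self_eq_zero_iff _).1 hz

variable {H K : Type*} [NormedAddCommGroup H] [InnerProductSpace ℂ H]
  [NormedAddCommGroup K] [InnerProductSpace ℂ K]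

theorem ContinuousLinearMap.nonneg_of_forall_inner_nonneg {T : H →L[ℂ] H}
    (h : ∀ f, 0 ≤ ⟪f, T f⟫_ℂ) : 0 ≤ T := by
  rw [nonneg_iff_isPositive, isPositive_iff_complex]
  intro f
  have h1 := h f
  rw [← inner_conj_symm, Complex.nonneg_iff, Complex.conj_re, Complex.conj_im] at h1
  exact ⟨Complex.ext rfl (by simpa [eq_comm] using h1.2), h1.1⟩

/-- The sum is `∑ⱼ ‖∑ₖ N j k (x k)‖²`. -/
theorem sum_inner_apply_nonneg {n : Type*} [Fintype n] (N : n → n → K →L[ℂ] K) (x : n → K) :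
    0 ≤ ∑ l, ∑ k, ∑ j, ⟪N j k (x k), N j l (x l)⟫_ℂ := by
  have key : ∑ l, ∑ k, ∑ j, ⟪N j k (x k), N j l (x l)⟫_ℂ =
      ∑ j, ⟪∑ k, N j k (x k), ∑ k, N j k (x k)⟫_ℂ := by
    calc _ = ∑ l, ∑ j, ∑ k, ⟪N j k (x k), N j l (x l)⟫_ℂ :=
          Finset.sum_congr rfl fun l _ => Finset.sum_comm
      _ = ∑ j, ∑ l, ∑ k, ⟪N j k (x k), N j l (x l)⟫_ℂ := Finset.sum_comm
      _ = _ := by simp only [inner_sum, sum_inner]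
  rw [key]
  refine Finset.sum_nonneg fun j _ => ?_
  rw [inner_self_eq_norm_sq_to_K]
  positivity

variable [CompleteSpace H]

theorem StarSubalgebra.coe_sum_star_mul_mul_apply (B : StarSubalgebra ℂ (H →L[ℂ] H)) {n : Type*}
    [Fintype n] (v : n → B) (O : n → n → B) (f : H) :
    ((∑ l, (∑ k, star (v k) * O k l) * v l : B) : H →L[ℂ] H) f =
      ∑ l, ∑ k, ((v k : H →L[ℂ] H)†) ((O k l : H →L[ℂ] H) ((v l : H →L[ℂ] H) f)) := by
  simp only [Finset.sum_mul, AddSubmonoidClass.coe_finsetSum, sum_apply]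
  rfl

/-- Pairing with `f` turns the form into a sum of squares at the vectors `V (v k f)`; this suffices
because the order on `B` is that of operators. -/
theorem StarSubalgebra.sum_star_mul_mul_nonneg {n : Type*} [Fintype n]
    (N : n → n → K →L[ℂ] K) (V : H →L[ℂ] K) {B : StarSubalgebra ℂ (H →L[ℂ] H)}
    {O : n → n → B}
    (hO : ∀ (k l : n) (f g : H),
      ⟪f, (O k l : H →L[ℂ] H) g⟫_ℂ = ∑ j, ⟪N j k (V f), N j l (V g)⟫_ℂ) (v : n → B) :
    0 ≤ ∑ l, (∑ k, star (v k) * O k l) * v l := by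
  have hpos (f : H) : 0 ≤ ⟪f, ((∑ l, (∑ k, star (v k) * O k l) * v l : B) : H →L[ℂ] H) f⟫_ℂ := by
    rw [StarSubalgebra.coe_sum_star_mul_mul_apply]
    simp only [inner_sum, ContinuousLinearMap.adjoint_inner_right, hO]
    exact sum_inner_apply_nonneg N fun k => V ((v k : H →L[ℂ] H) f)
  exact ContinuousLinearMap.nonneg_of_forall_inner_nonneg hpos

variable [CompleteSpace K] {A : Type*} [CStarAlgebra A] {B : StarSubalgebra ℂ (H →L[ℂ] H)}

theorem map_star_of_stinespring {T : A → B} (π : A →⋆ₐ[ℂ] (K →L[ℂ] K)) (V : H →L[ℂ] K)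
    (hT : ∀ a, (T a : H →L[ℂ] H) = (V†) ∘L π a ∘L V) (a : A) : T (star a) = star (T a) := by
  refine Subtype.ext ?_
  rw [StarMemClass.coe_star, hT, hT, map_star, ContinuousLinearMap.star_eq_adjoint,
    ContinuousLinearMap.star_eq_adjoint, ContinuousLinearMap.adjoint_comp,
    ContinuousLinearMap.adjoint_comp, ContinuousLinearMap.adjoint_adjoint]
  rfl

theorem inner_map_star_mul_self_apply (π : A →⋆ₐ[ℂ] (K →L[ℂ] K)) {n : Type*} [Fintype n]
    (N : CStarMatrix n n A) (k l : n) (x y : K) :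
    ⟪x, π ((star N * N) k l) y⟫_ℂ = ∑ j, ⟪π (N j k) x, π (N j l) y⟫_ℂ := by
  have h : π ((star N * N) k l) = ∑ j, (π (N j k))† ∘L π (N j l) := by
    rw [CStarMatrix.mul_apply]
    refine (map_sum π _ _).trans (Finset.sum_congr rfl fun j _ => ?_)
    rw [CStarMatrix.star_apply, map_mul, map_star]
    rfl
  rw [h, sum_apply, inner_sum]
  exact Finset.sum_congr rfl fun j _ =>
    ContinuousLinearMap.adjoint_inner_right (π (N j k)) x (π (N j l) y)

/-- A linear map from a C⋆-algebra to a C⋆-algebra of operators which has a Stinespring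
representation `a ↦ V⋆ π(a) V` is completely positive. -/
def CompletelyPositiveMap.ofStinespring [PartialOrder A] [StarOrderedRing A]
    [IsClosed (B : Set (H →L[ℂ] H))] [StarOrderedRing B] (T : A →ₗ[ℂ] B)
    (π : A →⋆ₐ[ℂ] (K →L[ℂ] K)) (V : H →L[ℂ] K)
    (hT : ∀ a, (T a : H →L[ℂ] H) = (V†) ∘L π a ∘L V) : A →CP B where
  toLinearMap := T
  map_cstarMatrix_nonneg' n M hM := by
    refine CStarMatrix.nonneg_of_forall_sum_nonneg ?_ fun v => ?_
    · ext k l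
      have := congrFun (congrFun (IsSelfAdjoint.of_nonneg hM).star_eq k) l
      rw [CStarMatrix.star_apply] at this ⊢
      rw [CStarMatrix.map_apply, CStarMatrix.map_apply, ← map_star_of_stinespring π V hT, this]
    · obtain ⟨N, rfl⟩ := NonUnitalCStarAlgebra.exists_eq_star_mul_self hM
      refine StarSubalgebra.sum_star_mul_mul_nonneg (fun j k => π (N j k)) V
        (fun k l f g => ?_) v
      rw [CStarMatrix.map_apply, ← inner_map_star_mul_self_apply π N k l]
      exact (congrArg (fun S => ⟪f, S g⟫_ℂ) (hT _)).trans
        (ContinuousLinearMap.adjoint_inner_right V _ _)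

end CompletelyPositive

/-! ### The diagonal representation on a Hilbert sum -/

section Amplification

theorem memℓp_two_iff {ι : Type*} {E : ι → Type*} [∀ i, NormedAddCommGroup (E i)]
    {f : ∀ i, E i} : Memℓp f 2 ↔ Summable fun i => ‖f i‖ ^ 2 := by
  rw [memℓp_gen_iff (by norm_num)]
  norm_num

theorem lp.hasSum_norm_sq {ι : Type*} {E : ι → Type*} [∀ i, NormedAddCommGroup (E i)]
    (f : lp E 2) : HasSum (fun i => ‖f i‖ ^ 2) (‖f‖ ^ 2) := by
  have := lp.hasSum_norm (p := 2) (by norm_num) f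
  norm_num at this
  exact this

variable (ι : Type*) {H : Type*} [NormedAddCommGroup H] [InnerProductSpace ℂ H]

theorem ContinuousLinearMap.norm_sq_apply_lp_le (a : H →L[ℂ] H) (f : lp (fun _ : ι => H) 2)
    (i : ι) : ‖a (f i)‖ ^ 2 ≤ ‖a‖ ^ 2 * ‖f i‖ ^ 2 := by
  rw [← mul_pow]
  gcongr
  exact a.le_opNorm _

theorem ContinuousLinearMap.memℓp_apply_lp (a : H →L[ℂ] H) (f : lp (fun _ : ι => H) 2) :
    Memℓp (fun i => a (f i)) 2 :=
  memℓp_two_iff.2 <| .of_nonneg_of_le (fun _ => by positivity) (a.norm_sq_apply_lp_le ι f)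
    ((lp.hasSum_norm_sq f).summable.mul_left _)

theorem ContinuousLinearMap.norm_apply_lp_le (a : H →L[ℂ] H) (f : lp (fun _ : ι => H) 2) :
    ‖(⟨fun i => a (f i), a.memℓp_apply_lp ι f⟩ : lp (fun _ : ι => H) 2)‖ ≤ ‖a‖ * ‖f‖ := by
  rw [← sq_le_sq₀ (norm_nonneg _) (by positivity), mul_pow]
  exact hasSum_le (a.norm_sq_apply_lp_le ι f)
    (lp.hasSum_norm_sq (⟨fun i => a (f i), a.memℓp_apply_lp ι f⟩ : lp (fun _ : ι => H) 2))
    ((lp.hasSum_norm_sq f).mul_left _)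

/-- The diagonal action of an operator on the Hilbert sum of copies of its domain. -/
noncomputable def ContinuousLinearMap.amplifyAux (a : H →L[ℂ] H) :
    lp (fun _ : ι => H) 2 →L[ℂ] lp (fun _ : ι => H) 2 :=
  LinearMap.mkContinuous
    { toFun f := ⟨fun i => a (f i), a.memℓp_apply_lp ι f⟩
      map_add' f g := by ext i; exact map_add a _ _
      map_smul' c f := by ext i; exact map_smul a _ _ }
    ‖a‖ (a.norm_apply_lp_le ι)

variable (H) [CompleteSpace H]

/-- The diagonal representation of the bounded operators on a Hilbert space `H` on the Hilbert sum
of copies of `H`. -/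
noncomputable def ContinuousLinearMap.amplify :
    (H →L[ℂ] H) →⋆ₐ[ℂ] (lp (fun _ : ι => H) 2 →L[ℂ] lp (fun _ : ι => H) 2) where
  toFun a := a.amplifyAux ι
  map_one' := rfl
  map_mul' _ _ := rfl
  map_zero' := rfl
  map_add' _ _ := rfl
  commutes' _ := rfl
  map_star' a := by
    rw [star_eq_adjoint, star_eq_adjoint, eq_adjoint_iff]
    intro f g
    rw [lp.inner_eq_tsum, lp.inner_eq_tsum]
    exact tsum_congr fun i => adjoint_inner_left a _ _

variable {H}

@[simp]
theorem ContinuousLinearMap.amplify_apply (a : H →L[ℂ] H) (f : lp (fun _ : ι => H) 2) (i : ι) :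
    amplify ι H a f i = a (f i) := rfl

theorem ContinuousLinearMap.norm_amplify_le (a : H →L[ℂ] H) : ‖amplify ι H a‖ ≤ ‖a‖ :=
  opNorm_le_bound _ (norm_nonneg _) (a.norm_apply_lp_le ι)

end Amplification

/-! ### Multiplication isometries and Schur multipliers -/

section Multiplication

variable {X ι : Type*} {v : ι → X → ℂ}

/-- Tonelli: summing over `i` first leaves `∑ |f y|²`. Summing over `y` first then shows that
multiplication by the `v i` is isometric. -/
theorem hasSum_norm_mul_sq_prod (hv : ∀ y, HasSum (fun i => ‖v i y‖ ^ 2) 1) (f : ℓ²(X, ℂ)) :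
    HasSum (fun p : ι × X => ‖f p.2 * v p.1 p.2‖ ^ 2) (‖f‖ ^ 2) := by
  have hy (y : X) : HasSum (fun i => ‖f y * v i y‖ ^ 2) (‖f y‖ ^ 2) := by
    simpa [mul_pow] using (hv y).mul_left (‖f y‖ ^ 2)
  have hs : Summable fun p : X × ι => ‖f p.1 * v p.2 p.1‖ ^ 2 := by
    refine (summable_prod_of_nonneg fun p => by positivity).2 ⟨fun y => (hy y).summable, ?_⟩
    simpa only [(hy _).tsum_eq] using (lp.hasSum_norm_sq f).summable
  have := hs.hasSum
  rw [(this.prod_fiberwise hy).unique (lp.hasSum_norm_sq f)] at this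
  exact (Equiv.prodComm ι X).hasSum_iff.2 this

/-- For a family of functions `v i` with `∑ |v i|² = 1`, the isometry from `ℓ²` to the Hilbert sum
of copies of `ℓ²` with components the multiplication operators by the `v i`. -/
noncomputable def multiplicationIsometry (hv : ∀ y, HasSum (fun i => ‖v i y‖ ^ 2) 1) :
    ℓ²(X, ℂ) →ₗᵢ[ℂ] lp (fun _ : ι => ℓ²(X, ℂ)) 2 :=
  have hs (f : ℓ²(X, ℂ)) (i : ι) : Memℓp (fun y => f y * v i y) 2 :=
    memℓp_two_iff.2 ((hasSum_norm_mul_sq_prod hv f).summable.prod_factor i)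
  have hn (f : ℓ²(X, ℂ)) :
      HasSum (fun i => ‖(⟨fun y => f y * v i y, hs f i⟩ : ℓ²(X, ℂ))‖ ^ 2) (‖f‖ ^ 2) :=
    (hasSum_norm_mul_sq_prod hv f).prod_fiberwise fun i =>
      lp.hasSum_norm_sq (⟨fun y => f y * v i y, hs f i⟩ : ℓ²(X, ℂ))
  { toFun f := ⟨fun i => ⟨fun y => f y * v i y, hs f i⟩, memℓp_two_iff.2 (hn f).summable⟩
    map_add' f g := by ext i y; exact add_mul _ _ _
    map_smul' c f := by ext i y; exact mul_assoc _ _ _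
    norm_map' f := by
      rw [← sq_eq_sq₀ (norm_nonneg _) (norm_nonneg _)]
      exact (lp.hasSum_norm_sq _).unique (hn f) }

@[simp]
theorem multiplicationIsometry_apply (hv : ∀ y, HasSum (fun i => ‖v i y‖ ^ 2) 1) (f : ℓ²(X, ℂ))
    (i : ι) (y : X) : (multiplicationIsometry hv f i : X → ℂ) y = f y * v i y := rfl

theorem multiplicationIsometry_single [DecidableEq X]
    (hv : ∀ y, HasSum (fun i => ‖v i y‖ ^ 2) 1) (y : X) (i : ι) :
    multiplicationIsometry hv (lp.single 2 y (1 : ℂ)) i = lp.single 2 y (v i y) := by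
  ext z
  rw [multiplicationIsometry_apply, lp.single_apply, lp.single_apply]
  by_cases hz : z = y
  · subst hz; simp
  · simp [hz]

/-- The Schur multiplier `a ↦ ∑ᵢ vᵢ⋆ a vᵢ` defined by a family of functions `vᵢ` with
`∑ |vᵢ|² = 1`. -/
noncomputable def ReducedGroup.schurMultiplier (hv : ∀ y, HasSum (fun i => ‖v i y‖ ^ 2) 1) :
    (ℓ²(X, ℂ) →L[ℂ] ℓ²(X, ℂ)) →ₗ[ℂ] (ℓ²(X, ℂ) →L[ℂ] ℓ²(X, ℂ)) where
  toFun a := ((multiplicationIsometry hv).toContinuousLinearMap†) ∘L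
    ContinuousLinearMap.amplify ι ℓ²(X, ℂ) a ∘L (multiplicationIsometry hv).toContinuousLinearMap
  map_add' a b := by rw [map_add, ContinuousLinearMap.add_comp, ContinuousLinearMap.comp_add]
  map_smul' c a := by
    rw [map_smul, ContinuousLinearMap.smul_comp, ContinuousLinearMap.comp_smul, RingHom.id_apply]

theorem ReducedGroup.norm_schurMultiplier_le (hv : ∀ y, HasSum (fun i => ‖v i y‖ ^ 2) 1)
    (a : ℓ²(X, ℂ) →L[ℂ] ℓ²(X, ℂ)) : ‖schurMultiplier hv a‖ ≤ ‖a‖ := by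
  have hV : ‖(multiplicationIsometry hv).toContinuousLinearMap‖ ≤ 1 :=
    LinearIsometry.norm_toContinuousLinearMap_le _
  have h : ‖schurMultiplier hv a‖ ≤ ‖(multiplicationIsometry hv).toContinuousLinearMap†‖ *
      (‖ContinuousLinearMap.amplify ι ℓ²(X, ℂ) a‖ *
        ‖(multiplicationIsometry hv).toContinuousLinearMap‖) :=
    (ContinuousLinearMap.opNorm_comp_le _ _).trans
      (mul_le_mul_of_nonneg_left (ContinuousLinearMap.opNorm_comp_le _ _) (norm_nonneg _))
  rw [LinearIsometryEquiv.norm_map] at h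
  calc ‖schurMultiplier hv a‖ ≤ 1 * (‖a‖ * 1) := h.trans (by
        gcongr; exact ContinuousLinearMap.norm_amplify_le ι a)
    _ = ‖a‖ := by ring

end Multiplication

/-! ### Multipliers of the reduced C⋆-algebra -/

noncomputable section

namespace ReducedGroup

variable {G : Type*} [Group G]

theorem regularRep_apply (x : G) (f : ℓ²(G, ℂ)) (y : G) :
    (regularRep G x f : G → ℂ) y = f (x⁻¹ * y) := rfl

theorem U_one : U (1 : G) = 1 := Subtype.ext (map_one (regularRep G))

theorem U_mul (x y : G) : U (x * y) = U x * U y := Subtype.ext (map_mul (regularRep G) x y)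

theorem star_U (x : G) : star (U x) = U x⁻¹ := by
  refine Subtype.ext ?_
  rw [StarMemClass.coe_star, ContinuousLinearMap.star_eq_adjoint, eq_comm,
    ContinuousLinearMap.eq_adjoint_iff]
  intro f g
  have h : g = regularRep G x⁻¹ (regularRep G x g) := by
    rw [← mul_apply_eq_comp, ← map_mul, inv_mul_cancel, map_one]
    rfl
  conv_lhs => rw [h]
  exact (translate x⁻¹).inner_map_map _ _

theorem star_regularRep (x : G) : star (regularRep G x) = regularRep G x⁻¹ :=
  congrArg Subtype.val (star_U x)

/-- The unitaries `U x` as a homomorphism. -/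
def UHom : G →* reducedCStarAlgebra G where
  toFun := U
  map_one' := U_one
  map_mul' := U_mul

/-- The image of a subgroup under a unitary representation spans the star algebra that it
generates. -/
theorem adjoin_image_subgroup {C : Type*} [Ring C] [StarRing C] [Algebra ℂ C] [StarModule ℂ C]
    (u : G →* C) (hu : ∀ x, star (u x) = u x⁻¹) (N : Subgroup G) :
    Subalgebra.toSubmodule (StarAlgebra.adjoin ℂ (u '' (N : Set G))).toSubalgebra =
      Submodule.span ℂ (u '' (N : Set G)) := by
  have hstar : star (u '' (N : Set G)) ⊆ u '' (N : Set G) := by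
    rintro a ⟨x, hx, h⟩
    exact ⟨x⁻¹, N.inv_mem hx, by rw [← hu, h, star_star]⟩
  rw [StarAlgebra.adjoin_eq_span, Set.union_eq_self_of_subset_right hstar]
  exact congrArg (fun T : Submonoid C => Submodule.span ℂ (T : Set C))
    (Submonoid.closure_eq (N.toSubmonoid.map u))

/-- The `U x` are closed under products and adjoints, so their span is already the star algebra
whose closure defines the reduced algebra. -/
theorem dense_span_range_U :
    Dense (Submodule.span ℂ (Set.range (U (G := G))) : Set (reducedCStarAlgebra G)) := by
  intro a
  rw [closure_subtype]
  have h := adjoin_image_subgroup (regularRep G) star_regularRep ⊤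
  rw [Subgroup.coe_top, Set.image_univ] at h
  have h2 : (Subtype.val '' (Submodule.span ℂ (Set.range (U (G := G))) :
      Set (reducedCStarAlgebra G))) =
      (StarAlgebra.adjoin ℂ (Set.range (regularRep G)) : Set (ℓ²(G, ℂ) →L[ℂ] ℓ²(G, ℂ))) := by
    refine (Submodule.map_coe (reducedCStarAlgebra G).subtype.toAlgHom.toLinearMap _).symm.trans ?_
    rw [Submodule.map_span, ← Set.range_comp]
    exact (congrArg SetLike.coe h).symm
  rw [h2]
  exact a.2

theorem completelyPositiveMap_ext {S T : reducedCStarAlgebra G →CP reducedCStarAlgebra G}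
    (h : ∀ x, S (U x) = T (U x)) : S = T := by
  refine DFunLike.coe_injective ?_
  refine Continuous.ext_on dense_span_range_U (map_continuous S) (map_continuous T) ?_
  exact LinearMap.eqOn_span (f := S.toLinearMap) (g := T.toLinearMap)
    (by rintro _ ⟨x, rfl⟩; exact h x)

section Multiplier

variable {ι : Type*} {v : ι → G → ℂ}

/-- Pairing with the delta function at `y` produces the Gram sum times `f (x⁻¹ * y)`; as the sum
does not depend on `y`, it comes out as a scalar. -/
theorem schurMultiplier_regularRep {φ : G → ℂ} (hv1 : ∀ y, HasSum (fun i => ‖v i y‖ ^ 2) 1)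
    (hv : ∀ x y, HasSum (fun i => star (v i y) * v i (x⁻¹ * y)) (φ x)) (x : G) :
    schurMultiplier hv1 (regularRep G x) = φ x • regularRep G x := by
  classical
  ext f y
  have h1 : ⟪lp.single 2 y (1 : ℂ), schurMultiplier hv1 (regularRep G x) f⟫_ℂ =
      ⟪multiplicationIsometry hv1 (lp.single 2 y (1 : ℂ)),
        ContinuousLinearMap.amplify ι ℓ²(G, ℂ) (regularRep G x)
          (multiplicationIsometry hv1 f)⟫_ℂ :=
    ContinuousLinearMap.adjoint_inner_right
      (multiplicationIsometry hv1).toContinuousLinearMap _ _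
  have h2 (i : ι) : ⟪multiplicationIsometry hv1 (lp.single 2 y (1 : ℂ)) i,
      ContinuousLinearMap.amplify ι ℓ²(G, ℂ) (regularRep G x)
        (multiplicationIsometry hv1 f) i⟫_ℂ =
      star (v i y) * v i (x⁻¹ * y) * f (x⁻¹ * y) := by
    rw [multiplicationIsometry_single, lp.inner_single_left, ContinuousLinearMap.amplify_apply,
      regularRep_apply, multiplicationIsometry_apply, RCLike.inner_apply, Complex.star_def]
    ring
  rw [lp.inner_single_left, RCLike.inner_apply, map_one, mul_one, lp.inner_eq_tsum,
    tsum_congr h2, ((hv x y).mul_right _).tsum_eq] at h1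
  exact h1

theorem schurMultiplier_mem {φ : G → ℂ} (hv1 : ∀ y, HasSum (fun i => ‖v i y‖ ^ 2) 1)
    (hv : ∀ x y, HasSum (fun i => star (v i y) * v i (x⁻¹ * y)) (φ x))
    (a : reducedCStarAlgebra G) : schurMultiplier hv1 a ∈ reducedCStarAlgebra G := by
  have hcont : Continuous (schurMultiplier hv1) :=
    AddMonoidHomClass.continuous_of_bound _ 1 (by simpa using norm_schurMultiplier_le hv1)
  have hcl : IsClosed {a : reducedCStarAlgebra G |
      schurMultiplier hv1 a ∈ reducedCStarAlgebra G} :=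
    (isClosed_reducedCStarAlgebra G).preimage (hcont.comp continuous_subtype_val)
  let W : Submodule ℂ (reducedCStarAlgebra G) :=
    (Subalgebra.toSubmodule (reducedCStarAlgebra G).toSubalgebra).comap
      (schurMultiplier hv1 ∘ₗ (reducedCStarAlgebra G).subtype.toAlgHom.toLinearMap)
  have hW : Submodule.span ℂ (Set.range U) ≤ W := by
    rw [Submodule.span_le]
    rintro _ ⟨x, rfl⟩
    change schurMultiplier hv1 (regularRep G x) ∈ reducedCStarAlgebra G
    rw [schurMultiplier_regularRep hv1 hv]
    exact (φ x • U x).2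
  exact closure_minimal hW hcl (dense_span_range_U a)

/-- A function `φ` on `G` with a Gram representation `φ x = ∑ᵢ conj (v i y) * v i (x⁻¹ * y)` is the
symbol of a completely positive contractive multiplier of the reduced C⋆-algebra. -/
theorem exists_multiplier {φ : G → ℂ} (h1 : φ 1 = 1)
    (hv : ∀ x y, HasSum (fun i => star (v i y) * v i (x⁻¹ * y)) (φ x)) :
    ∃ P : reducedCStarAlgebra G →CP reducedCStarAlgebra G,
      (∀ x, P (U x) = φ x • U x) ∧ ∀ a, ‖P a‖ ≤ ‖a‖ := by
  -- The Gram identity at `x = 1`.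
  have hv1 (y : G) : HasSum (fun i => ‖v i y‖ ^ 2) 1 := by
    have := hv 1 y
    simp only [inv_one, one_mul, h1, Complex.star_def, Complex.conj_mul'] at this
    rw [← Complex.hasSum_ofReal]
    simpa using this
  let T : reducedCStarAlgebra G →ₗ[ℂ] reducedCStarAlgebra G :=
    { toFun a := ⟨schurMultiplier hv1 a, schurMultiplier_mem hv1 hv a⟩
      map_add' a b := Subtype.ext (map_add (schurMultiplier hv1) _ _)
      map_smul' c a := Subtype.ext (map_smul (schurMultiplier hv1) _ _) }
  exact ⟨.ofStinespring T ((ContinuousLinearMap.amplify ι ℓ²(G, ℂ)).comp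
    (reducedCStarAlgebra G).subtype) (multiplicationIsometry hv1).toContinuousLinearMap
    fun _ => rfl, fun x => Subtype.ext (schurMultiplier_regularRep hv1 hv x),
    fun a => norm_schurMultiplier_le hv1 a⟩

end Multiplier

end ReducedGroup
end

/-! ### Orbits of contractions with densely spanning eigenvectors -/

section Orbits

variable {X : Type*} [NormedAddCommGroup X] [NormedSpace ℂ X]

/-- The vectors on which a uniformly bounded sequence of linear maps converges to zero form a
closed set. -/
theorem isClosed_setOf_tendsto_zero {T : ℕ → X →ₗ[ℂ] X} {C : ℝ} (hC : ∀ n x, ‖T n x‖ ≤ C * ‖x‖) :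
    IsClosed {x | Tendsto (fun n => T n x) atTop (𝓝 0)} := by
  refine isClosed_of_closure_subset fun x hx => ?_
  rw [Set.mem_ofPred_eq, Metric.tendsto_atTop]
  intro ε hε
  -- `|C| + 1` replaces `C`, whose sign is unknown, to keep the denominator positive.
  obtain ⟨y, hy, hxy⟩ := Metric.mem_closure_iff.1 hx (ε / (2 * (|C| + 1))) (by positivity)
  obtain ⟨N, hN⟩ := Metric.tendsto_atTop.1 hy (ε / 2) (by positivity)
  refine ⟨N, fun n hn => ?_⟩
  have h1 := hN n hn
  rw [dist_zero_right] at h1 ⊢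
  rw [dist_eq_norm, lt_div_iff₀ (by positivity)] at hxy
  have h2 : ‖T n (x - y)‖ ≤ (|C| + 1) * ‖x - y‖ :=
    (hC n _).trans (by gcongr; linarith [le_abs_self C])
  calc ‖T n x‖ = ‖T n (x - y) + T n y‖ := by rw [map_sub, sub_add_cancel]
    _ ≤ ‖T n (x - y)‖ + ‖T n y‖ := norm_add_le _ _
    _ < ε := by linarith

theorem norm_pow_apply_le {T : X →ₗ[ℂ] X} (hT : ∀ x, ‖T x‖ ≤ ‖x‖) (n : ℕ) (x : X) :
    ‖(T ^ n) x‖ ≤ ‖x‖ := by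
  induction n with
  | zero => simp
  | succ n ih => rw [pow_succ', Module.End.mul_apply]; exact (hT _).trans ih

theorem pow_apply_of_eq_smul {T : X →ₗ[ℂ] X} {x : X} {c : ℂ} (hx : T x = c • x) (n : ℕ) :
    (T ^ n) x = c ^ n • x := by
  induction n with
  | zero => simp
  | succ n ih => rw [pow_succ', Module.End.mul_apply, ih, map_smul, hx, smul_smul, pow_succ]

/-- The vectors with totally bounded orbit under a linear map. -/
def totallyBoundedOrbit [CompleteSpace X] (T : X →ₗ[ℂ] X) : Submodule ℂ X where
  carrier := {x | TotallyBounded (Set.range fun n : ℕ => (T ^ n) x)}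
  zero_mem' := by
    refine (Set.finite_singleton (0 : X)).totallyBounded.subset ?_
    rintro _ ⟨n, rfl⟩
    simp
  add_mem' {x y} hx hy := by
    -- By completeness the orbit closures are compact; the orbit of the sum lies in the image of
    -- their product under addition.
    have hx' := (TotallyBounded.closure hx).isCompact_of_isClosed isClosed_closure
    have hy' := (TotallyBounded.closure hy).isCompact_of_isClosed isClosed_closure
    refine ((hx'.prod hy').image continuous_add).totallyBounded.subset ?_
    rintro _ ⟨n, rfl⟩
    exact ⟨((T ^ n) x, (T ^ n) y), ⟨subset_closure ⟨n, rfl⟩, subset_closure ⟨n, rfl⟩⟩,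
      (map_add _ _ _).symm⟩
  smul_mem' c x hx := by
    refine (hx.image (uniformContinuous_const_smul c)).subset ?_
    rintro _ ⟨n, rfl⟩
    exact ⟨(T ^ n) x, ⟨n, rfl⟩, (map_smul _ _ _).symm⟩

theorem isClosed_totallyBoundedOrbit [CompleteSpace X] {T : X →ₗ[ℂ] X} (hT : ∀ x, ‖T x‖ ≤ ‖x‖) :
    IsClosed (totallyBoundedOrbit T : Set X) := by
  refine isClosed_of_closure_subset fun x hx => ?_
  refine Metric.totallyBounded_iff.2 fun ε hε => ?_
  obtain ⟨y, hy, hxy⟩ := Metric.mem_closure_iff.1 hx (ε / 2) (by positivity)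
  obtain ⟨t, ht, hyt⟩ := Metric.totallyBounded_iff.1 hy (ε / 2) (by positivity)
  refine ⟨t, ht, ?_⟩
  rintro _ ⟨n, rfl⟩
  obtain ⟨z, hz, hyz⟩ := Set.mem_iUnion₂.1 (hyt ⟨n, rfl⟩)
  refine Set.mem_iUnion₂.2 ⟨z, hz, ?_⟩
  have h1 : dist ((T ^ n) x) ((T ^ n) y) ≤ dist x y := by
    rw [dist_eq_norm, dist_eq_norm, ← map_sub]
    exact norm_pow_apply_le hT n _
  rw [Metric.mem_ball] at hyz ⊢
  linarith [dist_triangle ((T ^ n) x) ((T ^ n) y) z]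

/-- The orbit stays in the compact image of the unit disc under `z ↦ z • x`. -/
theorem mem_totallyBoundedOrbit_of_eigenvector [CompleteSpace X] {T : X →ₗ[ℂ] X} {x : X} {c : ℂ} (hc : ‖c‖ ≤ 1)
    (hx : T x = c • x) : x ∈ totallyBoundedOrbit T := by
  refine (((isCompact_closedBall (0 : ℂ) 1).image
    (f := fun z : ℂ => z • x) (by fun_prop)).totallyBounded).subset ?_
  rintro _ ⟨n, rfl⟩
  refine ⟨c ^ n, ?_, (pow_apply_of_eq_smul hx n).symm⟩
  rw [mem_closedBall_zero_iff, norm_pow]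
  exact pow_le_one₀ (norm_nonneg _) hc

theorem ReducedGroup.isLocallyFiniteContraction_of_dense [CompleteSpace X] {T : X →ₗ[ℂ] X}
    (hT : ∀ x, ‖T x‖ ≤ ‖x‖) {ι : Type*} {e : ι → X}
    (he : Dense (Submodule.span ℂ (Set.range e) : Set X))
    (h : ∀ i, ∃ c : ℂ, ‖c‖ ≤ 1 ∧ T (e i) = c • e i) : IsLocallyFiniteContraction T := by
  refine ⟨hT, fun x => ?_⟩
  have hle : Submodule.span ℂ (Set.range e) ≤ totallyBoundedOrbit T := by
    rw [Submodule.span_le]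
    rintro _ ⟨i, rfl⟩
    obtain ⟨c, hc, hi⟩ := h i
    exact mem_totallyBoundedOrbit_of_eigenvector hc hi
  have hx : TotallyBounded (Set.range fun n : ℕ => (T ^ n) x) :=
    closure_minimal hle (isClosed_totallyBoundedOrbit hT) (he x)
  exact hx.closure.isCompact_of_isClosed isClosed_closure

/-- If `X` is topologically spanned by fixed vectors of `E` and by vectors in the kernel of `E`
which `T` scales by a factor of modulus less than one, then the powers of `T` vanish asymptotically
on the range of `1 - E`. -/
theorem tendsto_norm_iterate_sub {T E : X →ₗ[ℂ] X} (hT : ∀ x, ‖T x‖ ≤ ‖x‖)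
    (hE : ∀ x, ‖E x‖ ≤ ‖x‖) {ι : Type*} {e : ι → X}
    (he : Dense (Submodule.span ℂ (Set.range e) : Set X))
    (h : ∀ i, E (e i) = e i ∨ ∃ c : ℂ, ‖c‖ < 1 ∧ T (e i) = c • e i ∧ E (e i) = 0) (x : X) :
    Tendsto (fun n => ‖T^[n] x - T^[n] (E x)‖) atTop (𝓝 0) := by
  let R (n : ℕ) : X →ₗ[ℂ] X := (T ^ n) ∘ₗ (LinearMap.id - E)
  have hR (n : ℕ) (x) : ‖R n x‖ ≤ 2 * ‖x‖ :=
    calc ‖R n x‖ ≤ ‖x - E x‖ := norm_pow_apply_le hT n _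
      _ ≤ ‖x‖ + ‖E x‖ := norm_sub_le _ _
      _ ≤ 2 * ‖x‖ := by linarith [hE x]
  let W : Submodule ℂ X :=
    { carrier := {x | Tendsto (fun n => R n x) atTop (𝓝 0)}
      zero_mem' := by simp
      add_mem' := fun {x y} hx hy => by simpa using! Tendsto.add hx hy
      smul_mem' := fun c x hx => by simpa using! Tendsto.const_smul hx c }
  have hW : Submodule.span ℂ (Set.range e) ≤ W := by
    rw [Submodule.span_le]
    rintro _ ⟨i, rfl⟩
    change Tendsto (fun n => (T ^ n) (e i - E (e i))) atTop (𝓝 0)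
    rcases h i with h | ⟨c, hc, hTc, h0⟩
    · simp [h]
    · have hpow (n : ℕ) : (T ^ n) (e i) = c ^ n • e i := pow_apply_of_eq_smul hTc n
      simp only [h0, sub_zero, hpow]
      simpa using (tendsto_pow_atTop_nhds_zero_of_norm_lt_one hc).smul_const (e i)
  have hx : Tendsto (fun n => R n x) atTop (𝓝 0) :=
    closure_minimal hW (isClosed_setOf_tendsto_zero hR) (he x)
  refine (tendsto_norm_zero.comp hx).congr fun n => ?_
  rw [← Module.End.pow_apply, ← Module.End.pow_apply, ← map_sub]
  rfl

end Orbits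

/-! ### Gram representation and multiplicativity from GNS -/

section GNS

namespace PositiveLinearMap

variable {A : Type*} [CStarAlgebra A] [PartialOrder A] [StarOrderedRing A] (f : A →ₚ[ℂ] ℂ)

/-- The sesquilinear form of a positive functional is a sum of rank one forms. -/
theorem exists_hasSum_star_mul :
    ∃ (s : Set f.GNS) (v : s → A → ℂ), ∀ a b, HasSum (fun i => star (v i a) * v i b)
      (f (star a * b)) := by
  obtain ⟨w, e, -⟩ := exists_hilbertBasis ℂ f.GNS
  refine ⟨w, fun i a => ⟪e i, (f.toPreGNS a : f.GNS)⟫_ℂ, fun a b => ?_⟩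
  have h := e.hasSum_inner_mul_inner (f.toPreGNS a : f.GNS) (f.toPreGNS b : f.GNS)
  rw [UniformSpace.Completion.inner_coe, preGNS_inner_def, ofPreGNS_toPreGNS,
    ofPreGNS_toPreGNS] at h
  have he : (fun i => star ⟪e i, (f.toPreGNS a : f.GNS)⟫_ℂ * ⟪e i, (f.toPreGNS b : f.GNS)⟫_ℂ) =
      fun i => ⟪(f.toPreGNS a : f.GNS), e i⟫_ℂ * ⟪e i, (f.toPreGNS b : f.GNS)⟫_ℂ :=
    funext fun i => congrArg (· * _) (inner_conj_symm (𝕜 := ℂ) (f.toPreGNS a : f.GNS) (e i))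
  exact he ▸ h

/-- Cauchy–Schwarz for the GNS form. -/
theorem map_star_mul_eq_zero {c : A} (hc : f (star c * c) = 0) (a : A) : f (star c * a) = 0 := by
  have h0 : ‖f.toPreGNS c‖ = 0 := by
    rw [preGNS_norm_def, ofPreGNS_toPreGNS, hc]
    simp
  have h1 := norm_inner_le_norm (𝕜 := ℂ) (E := f.PreGNS) (f.toPreGNS c) (f.toPreGNS a)
  rwa [h0, zero_mul, norm_le_zero_iff, preGNS_inner_def, ofPreGNS_toPreGNS,
    ofPreGNS_toPreGNS] at h1

/-- A state is multiplicative on a unitary where it has modulus one. -/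
theorem map_mul_of_norm_map_eq_one (h1 : f 1 = 1) {u : A} (hu : u * star u = 1) (hf : ‖f u‖ = 1)
    (a : A) : f (u * a) = f u * f a := by
  have hc : star (star u - star (f u) • 1) = u - f u • 1 := by
    rw [star_sub, star_star, star_smul, star_star, star_one]
  -- The value is `1 - |f u|²`, so `f` annihilates `(u - f u) a` for every `a`.
  have h0 : f (star (star u - star (f u) • 1) * (star u - star (f u) • 1)) = 0 := by
    rw [hc, sub_mul, mul_sub, mul_sub, hu]
    simp only [mul_smul_comm, smul_mul_assoc, mul_one, one_mul, map_sub, map_smul, h1,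
      map_star, smul_eq_mul, Complex.star_def]
    rw [mul_comm (starRingEnd ℂ _), Complex.mul_conj', hf]
    simp
  have h2 := f.map_star_mul_eq_zero h0 a
  rwa [hc, sub_mul, smul_mul_assoc, one_mul, map_sub, map_smul, smul_eq_mul, sub_eq_zero] at h2

end PositiveLinearMap

end GNS

theorem StarSubalgebra.coe_starAlgEquiv_pow {A : Type*} [Ring A] [StarRing A] [Algebra ℂ A]
    [StarModule ℂ A] {B : StarSubalgebra ℂ A} (α : B ≃⋆ₐ[ℂ] B) {f : A → A}
    (h : ∀ b : B, (α b : A) = f b) (n : ℕ) (b : B) : (((α ^ n) b : B) : A) = f^[n] b := by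
  induction n with
  | zero => rfl
  | succ n ih =>
    rw [pow_succ', Function.iterate_succ_apply', ← ih, ← h]
    rfl

/-! ### The peripheral subgroup, automorphism and conditional expectation -/

noncomputable section

namespace ReducedGroup

variable {G : Type*} [Group G]

theorem mem_of_isClosed {W : Submodule ℂ (reducedCStarAlgebra G)}
    (hW : IsClosed (W : Set (reducedCStarAlgebra G))) (h : ∀ x, U x ∈ W)
    (a : reducedCStarAlgebra G) : a ∈ W :=
  closure_minimal (Submodule.span_le.2 (by rintro _ ⟨x, rfl⟩; exact h x)) hW (dense_span_range_U a)

/-- The indicator functions of the cosets of a subgroup give a Gram representation of the indicator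
function of the subgroup. -/
theorem hasSum_coset_indicator (N : Subgroup G) [DecidableEq (Quotient (QuotientGroup.rightRel N))]
    [DecidablePred (· ∈ N)] (x y : G) :
    HasSum (fun i : Quotient (QuotientGroup.rightRel N) =>
      star (if Quotient.mk _ y = i then 1 else 0 : ℂ) *
        (if Quotient.mk _ (x⁻¹ * y) = i then 1 else 0)) (if x ∈ N then 1 else 0) := by
  -- Cosets `N y` are needed: left translation by `x⁻¹` fixes such a coset exactly when `x ∈ N`.
  have hx : (Quotient.mk (QuotientGroup.rightRel N) (x⁻¹ * y) = Quotient.mk _ y) ↔ x ∈ N := by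
    rw [Quotient.eq, QuotientGroup.rightRel_apply]
    simp
  convert hasSum_single (Quotient.mk (QuotientGroup.rightRel N) y) fun i hi => ?_ using 1
  · simp [hx]
  · simp [hi.symm]

variable {ρ : reducedCStarAlgebra G →ₚ[ℂ] ℂ}

/-- The coefficients of a state have a Gram representation. -/
theorem exists_hasSum_state (ρ : reducedCStarAlgebra G →ₚ[ℂ] ℂ) :
    ∃ (s : Set ρ.GNS) (v : s → G → ℂ),
      ∀ x y, HasSum (fun i => star (v i y) * v i (x⁻¹ * y)) (ρ (U x)) := by
  obtain ⟨ι, v, hv⟩ := ρ.exists_hasSum_star_mul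
  -- The inverse is forced by `star (U y⁻¹) * U (x⁻¹ * y)⁻¹ = U x`.
  refine ⟨ι, fun i y => v i (U y⁻¹), fun x y => ?_⟩
  have h := hv (U y⁻¹) (U (x⁻¹ * y)⁻¹)
  rwa [star_U, ← U_mul, show y⁻¹⁻¹ * (x⁻¹ * y)⁻¹ = x by group] at h

theorem state_U_inv (x : G) : ρ (U x⁻¹) = star (ρ (U x)) := by
  rw [← star_U, map_star]

theorem state_U_mul (hρ : ρ 1 = 1) {x : G} (hx : ‖ρ (U x)‖ = 1) (y : G) :
    ρ (U (x * y)) = ρ (U x) * ρ (U y) := by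
  rw [U_mul]
  exact ρ.map_mul_of_norm_map_eq_one hρ (by rw [star_U, ← U_mul, mul_inv_cancel, U_one]) hx _

/-- The subgroup where the coefficient of a state has modulus one. -/
def peripheralSubgroup (hρ : ρ 1 = 1) : Subgroup G where
  carrier := {x | ‖ρ (U x)‖ = 1}
  one_mem' := by simp [U_one, hρ]
  mul_mem' {x y} hx hy := by
    rw [Set.mem_ofPred_eq] at hx hy ⊢
    rw [state_U_mul hρ hx, norm_mul, hx, hy, one_mul]
  inv_mem' {x} hx := by
    rw [Set.mem_ofPred_eq] at hx ⊢
    rw [state_U_inv, norm_star, hx]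

theorem U_mem_peripheralSubalgebra {x : G} (hx : ‖ρ (U x)‖ = 1) : U x ∈ peripheralSubalgebra ρ :=
  StarSubalgebra.le_topologicalClosure _ (StarAlgebra.subset_adjoin ℂ _ ⟨x, hx, rfl⟩)

theorem isClosed_peripheralSubalgebra :
    IsClosed (peripheralSubalgebra ρ : Set (reducedCStarAlgebra G)) :=
  StarSubalgebra.isClosed_topologicalClosure _

/-- Because the modulus-one elements form a subgroup, their unitaries span a star algebra, so closed
subspaces suffice for induction. -/
theorem mem_of_mem_peripheralSubalgebra (hρ : ρ 1 = 1) {W : Submodule ℂ (reducedCStarAlgebra G)}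
    (hW : IsClosed (W : Set (reducedCStarAlgebra G))) (h : ∀ x, ‖ρ (U x)‖ = 1 → U x ∈ W)
    {b : reducedCStarAlgebra G} (hb : b ∈ peripheralSubalgebra ρ) : b ∈ W := by
  have hadj := adjoin_image_subgroup (UHom (G := G)) star_U (peripheralSubgroup hρ)
  have hle : Submodule.span ℂ (UHom '' (peripheralSubgroup hρ : Set G)) ≤ W := by
    rw [Submodule.span_le]
    rintro _ ⟨x, hx, rfl⟩
    exact h x hx
  rw [← hadj] at hle
  exact closure_minimal hle hW hb

variable (P : reducedCStarAlgebra G →CP reducedCStarAlgebra G)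

theorem map_mem_peripheralSubalgebra (hρ : ρ 1 = 1) {φ : G → ℂ} (hP : ∀ x, P (U x) = φ x • U x)
    {b : reducedCStarAlgebra G} (hb : b ∈ peripheralSubalgebra ρ) :
    P b ∈ peripheralSubalgebra ρ :=
  mem_of_mem_peripheralSubalgebra hρ
    (W := (Subalgebra.toSubmodule (peripheralSubalgebra ρ).toSubalgebra).comap P.toLinearMap)
    (isClosed_peripheralSubalgebra.preimage (map_continuous P))
    (fun x hx => by
      change P (U x) ∈ peripheralSubalgebra ρ
      rw [hP]
      exact SMulMemClass.smul_mem _ (U_mem_peripheralSubalgebra hx)) hb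

/-- The symbol satisfies `ρ (U (x * y)) = ρ (U x) * ρ (U y)` for peripheral `x`. Density extends
this first in the right factor, then in the left. -/
theorem map_mul_of_mem_peripheralSubalgebra (hρ : ρ 1 = 1) (hP : ∀ x, P (U x) = ρ (U x) • U x)
    {b : reducedCStarAlgebra G} (hb : b ∈ peripheralSubalgebra ρ) (a : reducedCStarAlgebra G) :
    P (b * a) = P b * P a := by
  have hcont := map_continuous P
  have hU (x : G) (hx : ‖ρ (U x)‖ = 1) : P (U x * a) = P (U x) * P a :=
    mem_of_isClosed
      (W := LinearMap.eqLocus (P.toLinearMap ∘ₗ LinearMap.mulLeft ℂ (U x))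
        (LinearMap.mulLeft ℂ (P (U x)) ∘ₗ P.toLinearMap))
      (isClosed_eq (f := fun a => P (U x * a)) (g := fun a => P (U x) * P a)
        (by fun_prop) (by fun_prop))
      (fun y => by
        change P (U x * U y) = P (U x) * P (U y)
        rw [← U_mul, hP, hP, hP, state_U_mul hρ hx, smul_mul_smul_comm, U_mul]) a
  exact mem_of_mem_peripheralSubalgebra hρ
    (W := LinearMap.eqLocus (P.toLinearMap ∘ₗ LinearMap.mulRight ℂ a)
        (LinearMap.mulRight ℂ (P a) ∘ₗ P.toLinearMap))
    (isClosed_eq (f := fun b => P (b * a)) (g := fun b => P b * P a)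
        (by fun_prop) (by fun_prop)) hU hb

variable {P} in
theorem comp_apply_of_mem_peripheralSubalgebra (hρ : ρ 1 = 1)
    {Q : reducedCStarAlgebra G →CP reducedCStarAlgebra G}
    (h : ∀ x, ‖ρ (U x)‖ = 1 → P (Q (U x)) = U x)
    {b : reducedCStarAlgebra G} (hb : b ∈ peripheralSubalgebra ρ) : P (Q b) = b :=
  mem_of_mem_peripheralSubalgebra hρ
    (W := LinearMap.eqLocus (P.toLinearMap ∘ₗ Q.toLinearMap) LinearMap.id)
    (isClosed_eq (f := fun b => P (Q b)) ((map_continuous P).comp (map_continuous Q))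
      continuous_id) h hb

variable {P} in
/-- The restriction of the multiplier `P` to the peripheral subalgebra, with inverse the multiplier
`Q` with the conjugate symbol. -/
def peripheralAut (hρ : ρ 1 = 1) (hP : ∀ x, P (U x) = ρ (U x) • U x)
    {Q : reducedCStarAlgebra G →CP reducedCStarAlgebra G}
    (hQ : ∀ x, Q (U x) = star (ρ (U x)) • U x) :
    peripheralSubalgebra ρ ≃⋆ₐ[ℂ] peripheralSubalgebra ρ where
  toFun b := ⟨P b, map_mem_peripheralSubalgebra P hρ hP b.2⟩
  invFun b := ⟨Q b, map_mem_peripheralSubalgebra Q hρ hQ b.2⟩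
  left_inv b := Subtype.ext <| comp_apply_of_mem_peripheralSubalgebra hρ (fun x hx => by
    rw [hP, map_smul, hQ, smul_smul, Complex.star_def, Complex.mul_conj', hx]; simp) b.2
  right_inv b := Subtype.ext <| comp_apply_of_mem_peripheralSubalgebra hρ (fun x hx => by
    rw [hQ, map_smul, hP, smul_smul, Complex.star_def, Complex.conj_mul', hx]; simp) b.2
  map_mul' a b := Subtype.ext <| map_mul_of_mem_peripheralSubalgebra P hρ hP a.2 b
  map_add' a b := Subtype.ext <| map_add P _ _
  map_star' a := Subtype.ext <| map_star P _
  map_smul' c a := Subtype.ext <| map_smul P _ _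

/-- The coefficients of a state and their conjugates are symbols of completely positive
contractions. -/
theorem exists_state_multiplier (hρ : ρ 1 = 1) :
    (∃ P : reducedCStarAlgebra G →CP reducedCStarAlgebra G,
      (∀ x, P (U x) = ρ (U x) • U x) ∧ ∀ a, ‖P a‖ ≤ ‖a‖) ∧
    ∃ Q : reducedCStarAlgebra G →CP reducedCStarAlgebra G, ∀ x, Q (U x) = star (ρ (U x)) • U x := by
  have h1 : ρ (U (1 : G)) = 1 := by rw [U_one, hρ]
  obtain ⟨s, v, hv⟩ := exists_hasSum_state ρ
  refine ⟨exists_multiplier (φ := fun x => ρ (U x)) h1 hv, ?_⟩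
  obtain ⟨Q, hQ, -⟩ := exists_multiplier (φ := fun x => star (ρ (U x)))
    (v := fun i y => star (v i y)) (by rw [h1, star_one]) fun x y => by
      simpa only [star_mul', star_star] using (hv x y).star
  exact ⟨Q, hQ⟩

/-- The indicator function of a subgroup is the symbol of a completely positive contraction. -/
theorem exists_subgroup_multiplier (N : Subgroup G) :
    ∃ E : reducedCStarAlgebra G →CP reducedCStarAlgebra G,
      (∀ x, (x ∈ N → E (U x) = U x) ∧ (x ∉ N → E (U x) = 0)) ∧ ∀ a, ‖E a‖ ≤ ‖a‖ := by
  classical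
  obtain ⟨E, hE, hEn⟩ := exists_multiplier (φ := fun x => if x ∈ N then 1 else 0)
    (if_pos (one_mem _)) (hasSum_coset_indicator N)
  refine ⟨E, fun x => ⟨fun hx => ?_, fun hx => ?_⟩, hEn⟩
  · rw [hE, if_pos hx, one_smul]
  · rw [hE, if_neg hx, zero_smul]

theorem U_ne_zero (hρ : ρ 1 = 1) (x : G) : U x ≠ 0 := fun h => by
  rw [← U_one, ← mul_inv_cancel x, U_mul, h, zero_mul, map_zero] at hρ
  exact zero_ne_one hρ

-- `U x` is a nonzero eigenvector of the contraction `P`.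
variable {P} in
theorem norm_state_U_le (hρ : ρ 1 = 1) (hP : ∀ x, P (U x) = ρ (U x) • U x)
    (hPn : ∀ a, ‖P a‖ ≤ ‖a‖) (x : G) : ‖ρ (U x)‖ ≤ 1 := by
  have := hPn (U x)
  rw [hP, norm_smul] at this
  exact le_of_mul_le_mul_right (by simpa using this) (norm_pos_iff.2 (U_ne_zero hρ x))

section ConditionalExpectation

variable {E : reducedCStarAlgebra G →CP reducedCStarAlgebra G}

theorem conditionalExpectation_mem (hle : ∀ x, ‖ρ (U x)‖ ≤ 1)
    (hE1 : ∀ x, ‖ρ (U x)‖ = 1 → E (U x) = U x) (hE0 : ∀ x, ‖ρ (U x)‖ < 1 → E (U x) = 0)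
    (a : reducedCStarAlgebra G) : E a ∈ peripheralSubalgebra ρ := by
  refine mem_of_isClosed
    (W := (Subalgebra.toSubmodule (peripheralSubalgebra ρ).toSubalgebra).comap E.toLinearMap)
    (isClosed_peripheralSubalgebra.preimage (map_continuous E)) (fun x => ?_) a
  change E (U x) ∈ peripheralSubalgebra ρ
  rcases (hle x).eq_or_lt with h | h
  · rw [hE1 x h]; exact U_mem_peripheralSubalgebra h
  · rw [hE0 x h]; exact zero_mem _

theorem conditionalExpectation_eq_self (hρ : ρ 1 = 1)
    (hE1 : ∀ x, ‖ρ (U x)‖ = 1 → E (U x) = U x)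
    {b : reducedCStarAlgebra G} (hb : b ∈ peripheralSubalgebra ρ) : E b = b :=
  mem_of_mem_peripheralSubalgebra hρ (W := LinearMap.eqLocus E.toLinearMap LinearMap.id)
    (isClosed_eq (map_continuous E) continuous_id) hE1 hb

theorem tendsto_norm_iterate_sub_conditionalExpectation (hle : ∀ x, ‖ρ (U x)‖ ≤ 1)
    {P : reducedCStarAlgebra G →CP reducedCStarAlgebra G} (hP : ∀ x, P (U x) = ρ (U x) • U x)
    (hPn : ∀ a, ‖P a‖ ≤ ‖a‖) (hEn : ∀ a, ‖E a‖ ≤ ‖a‖)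
    (hE1 : ∀ x, ‖ρ (U x)‖ = 1 → E (U x) = U x) (hE0 : ∀ x, ‖ρ (U x)‖ < 1 → E (U x) = 0)
    (a : reducedCStarAlgebra G) :
    Tendsto (fun n => ‖P^[n] a - P^[n] (E a)‖) atTop (𝓝 0) :=
  tendsto_norm_iterate_sub (T := P.toLinearMap) (E := E.toLinearMap) hPn hEn dense_span_range_U
    (fun x => (hle x).eq_or_lt.imp (hE1 x) fun h => ⟨_, h, hP x, hE0 x h⟩) a

theorem conditionalExpectation_unique (hle : ∀ x, ‖ρ (U x)‖ ≤ 1)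
    (hE : ∀ x, (‖ρ (U x)‖ = 1 → E (U x) = U x) ∧ (‖ρ (U x)‖ < 1 → E (U x) = 0))
    {F : reducedCStarAlgebra G →CP reducedCStarAlgebra G}
    (hF : ∀ x, (‖ρ (U x)‖ = 1 → F (U x) = U x) ∧ (‖ρ (U x)‖ < 1 → F (U x) = 0)) : F = E := by
  refine completelyPositiveMap_ext fun x => ?_
  rcases (hle x).eq_or_lt with h | h
  · exact ((hF x).1 h).trans ((hE x).1 h).symm
  · exact ((hF x).2 h).trans ((hE x).2 h).symm

end ConditionalExpectation

end ReducedGroup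

end

open ReducedGroup
set_option maxHeartbeats 1000000 in
theorem proposition4p2 {G : Type*} [Group G]
    (ρ : reducedCStarAlgebra G →ₚ[ℂ] ℂ) (hρ : ρ 1 = 1) :
    ∃ P : reducedCStarAlgebra G →CP reducedCStarAlgebra G,
      (∀ x : G, P (U x) = ρ (U x) • U x) ∧
      (∀ P' : reducedCStarAlgebra G →CP reducedCStarAlgebra G,
        (∀ x : G, P' (U x) = ρ (U x) • U x) → P' = P) ∧
      IsLocallyFiniteContraction P.toLinearMap ∧
      ∃ α : peripheralSubalgebra ρ ≃⋆ₐ[ℂ] peripheralSubalgebra ρ,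
        (∀ b : peripheralSubalgebra ρ,
          ((α b : peripheralSubalgebra ρ) : reducedCStarAlgebra G) = P b) ∧
        ∃ E : reducedCStarAlgebra G →CP reducedCStarAlgebra G,
          (∀ x : G, (‖ρ (U x)‖ = 1 → E (U x) = U x) ∧ (‖ρ (U x)‖ < 1 → E (U x) = 0)) ∧
          (∀ E' : reducedCStarAlgebra G →CP reducedCStarAlgebra G,
            (∀ x : G, (‖ρ (U x)‖ = 1 → E' (U x) = U x) ∧ (‖ρ (U x)‖ < 1 → E' (U x) = 0)) →
              E' = E) ∧
          (∀ a : reducedCStarAlgebra G, E (E a) = E a) ∧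
          Set.range E = (peripheralSubalgebra ρ : Set (reducedCStarAlgebra G)) ∧
          ∃ hE : ∀ a : reducedCStarAlgebra G, E a ∈ peripheralSubalgebra ρ,
            ∀ a : reducedCStarAlgebra G,
              Tendsto (fun n : ℕ =>
                ‖(P : reducedCStarAlgebra G → reducedCStarAlgebra G)^[n] a -
                  (((α ^ n) ⟨E a, hE a⟩ : peripheralSubalgebra ρ) : reducedCStarAlgebra G)‖)
                atTop (𝓝 0) := by
  have hPQ := exists_state_multiplier hρ
  refine hPQ.1.elim fun P hP' => hPQ.2.elim fun Q hQ =>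
    (exists_subgroup_multiplier (peripheralSubgroup hρ)).elim fun E hE' => ?_
  have hP := hP'.1
  have hPn := hP'.2
  have hE := hE'.1
  have hEn := hE'.2
  have hE1 (x : G) (hx : ‖ρ (U x)‖ = 1) : E (U x) = U x := (hE x).1 hx
  have hE0 (x : G) (hx : ‖ρ (U x)‖ < 1) : E (U x) = 0 := (hE x).2 hx.ne
  have hle := norm_state_U_le hρ hP hPn
  have hEB := conditionalExpectation_mem hle hE1 hE0
  have hEid (b : reducedCStarAlgebra G) (hb : b ∈ peripheralSubalgebra ρ) : E b = b :=
    conditionalExpectation_eq_self hρ hE1 hb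
  have hPlf : IsLocallyFiniteContraction P.toLinearMap :=
    isLocallyFiniteContraction_of_dense hPn dense_span_range_U fun x => ⟨_, hle x, hP x⟩
  have hlim := tendsto_norm_iterate_sub_conditionalExpectation hle hP hPn hEn hE1 hE0
  -- Iterates of the automorphism are iterates of `P`, so `hlim` is the required limit.
  have hα (n : ℕ) (b : peripheralSubalgebra ρ) :=
    StarSubalgebra.coe_starAlgEquiv_pow (f := P) (peripheralAut hρ hP hQ) (fun _ => rfl) n b
  exact ⟨P, hP, fun P' hP' => completelyPositiveMap_ext fun x => (hP' x).trans (hP x).symm,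
    hPlf, peripheralAut hρ hP hQ, fun _ => rfl, E, fun x => ⟨hE1 x, hE0 x⟩,
    fun _ => conditionalExpectation_unique hle fun x => ⟨hE1 x, hE0 x⟩,
    fun a => hEid _ (hEB a),
    Set.Subset.antisymm (Set.range_subset_iff.2 hEB) fun b hb => ⟨b, hEid b hb⟩, hEB,
    fun a => (hlim a).congr fun n => congrArg (fun z => ‖P^[n] a - z‖) (hα n ⟨E a, hEB a⟩).symm⟩
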